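/- Let $K_1,K_2$ be complex Hilbert spaces (inner products linear in the second argument), let $H=K_1\oplus K_2$ be their Hilbert space direct sum, and let $P:H\to K_1$ be the canonical projection. Let $A_j$ be a bounded selfadjoint operator on $K_j$ for $j=1,2$, and let $\varphi\in H$ be such that $\varphi_1=P\varphi$ is cyclic for $A_1$ and $\varphi_2=(1-P)\varphi$ is cyclic for $A_2$, that is, the linear span of $\{A_j^n\varphi_j : n\ge 0\}$ is dense in $K_j$. Let $\lambda\in\mathbb{R}\setminus\{0\}$. Then the bounded selfadjoint operator $$C=A_1\oplus A_2+\lambda\langle\varphi,\,\cdot\,\rangle\varphi$$ on $H$ has simple singular spectrum. Here, for $\psi\in H$, let $\mu_\psi^C$ be the spectral measure of $\psi$ for $C$, i.e. the measure on $\mathbb{R}$ with $\int f\,d\mu_\psi^C=\langle\psi,f(C)\psi\rangle$ for all compactly supported continuous $f:\mathbb{R}\to\mathbb{R}$, and let $H_{\mathrm s}(C)$ be the set of all $\psi\in H$ for which $\mu_\psi^C$ is singular with respect to Lebesgue measure. That $C$ has simple singular spectrum means that $C\restriction H_{\mathrm s}(C)$ has a cyclic vector: there is $\psi\in H_{\mathrm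 s}(C)$ such that $H_{\mathrm s}(C)$ is the closed linear span of $\{C^n\psi : n\ge 0\}$. -/

import Mathlib

open scoped InnerProductSpace CompactlySupported
open MeasureTheory

noncomputable section

/-- The cyclic subspace of `ψ` under the bounded operator `A`: the closed linear span of
`ψ, Aψ, A²ψ, …`. -/
def cyclicSubspace {H : Type*} [NormedAddCommGroup H] [InnerProductSpace ℂ H]
    (A : H →L[ℂ] H) (ψ : H) : Submodule ℂ H :=
  (Submodule.span ℂ (Set.range fun n : ℕ => (A ^ n) ψ)).topologicalClosure

/-- `ψ` is a cyclic vector for `A`. -/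
def IsCyclicVector {H : Type*} [NormedAddCommGroup H] [InnerProductSpace ℂ H]
    (A : H →L[ℂ] H) (ψ : H) : Prop :=
  cyclicSubspace A ψ = ⊤

/-- The positive linear functional `f ↦ ⟨ψ, f(A) ψ⟩` on compactly supported continuous
`f : ℝ → ℝ`, where `f(A)` is the continuous functional calculus of the selfadjoint operator `A`
(the number `⟨ψ, f(A) ψ⟩` is real). If `A` is not selfadjoint, the functional is zero. -/
def spectralFunctional {H : Type*} [NormedAddCommGroup H] [InnerProductSpace ℂ H]
    [CompleteSpace H] (A : H →L[ℂ] H) (ψ : H) : C_c(ℝ, ℝ) →ₚ[ℝ] ℝ :=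
  PositiveLinearMap.mk₀
    { toFun := fun f => (⟪ψ, (cfc (fun x : ℝ => f x) A) ψ⟫_ℂ).re
      map_add' := by
        intro f g
        have h : cfc (fun x : ℝ => (f + g) x) A
            = cfc (fun x : ℝ => f x) A + cfc (fun x : ℝ => g x) A :=
          cfc_add A (fun x : ℝ => f x) (fun x : ℝ => g x)
            f.continuous.continuousOn g.continuous.continuousOn
        rw [h]
        simp
      map_smul' := by
        intro r f
        have h : cfc (fun x : ℝ => (r • f) x) A = r • cfc (fun x : ℝ => f x) A :=
          cfc_smul r (fun x : ℝ => f x) A f.continuous.continuousOn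
        rw [h]
        simp [inner_smul_right_eq_smul] }
    (by
      intro f hf
      have h : 0 ≤ cfc (fun x : ℝ => f x) A := cfc_nonneg fun x _ => hf x
      exact ((ContinuousLinearMap.nonneg_iff_isPositive _).1 h).re_inner_nonneg_right ψ)

/-- The spectral measure of the vector `ψ` for the bounded selfadjoint operator `A`: the measure
`μ` on `ℝ` with `∫ f dμ = ⟨ψ, f(A) ψ⟩`, given by the Riesz–Markov–Kakutani theorem. -/
def spectralMeasure {H : Type*} [NormedAddCommGroup H] [InnerProductSpace ℂ H]
    [CompleteSpace H] (A : H →L[ℂ] H) (ψ : H) : Measure ℝ :=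
  RealRMK.rieszMeasure (spectralFunctional A ψ)

/-- The singular subspace of `A`: the vectors whose spectral measure is singular with respect to
Lebesgue measure. -/
def singularSubspace {H : Type*} [NormedAddCommGroup H] [InnerProductSpace ℂ H]
    [CompleteSpace H] (A : H →L[ℂ] H) : Set H :=
  {ψ | spectralMeasure A ψ ⟂ₘ (volume : Measure ℝ)}

/-- `A` has simple singular spectrum: the restriction of `A` to its singular subspace has a
cyclic vector, i.e. the singular subspace is the cyclic subspace of some vector
(which then lies in it). -/
def HasSimpleSingularSpectrum {H : Type*} [NormedAddCommGroup H] [InnerProductSpace ℂ H]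
    [CompleteSpace H] (A : H →L[ℂ] H) : Prop :=
  ∃ ψ : H, (cyclicSubspace A ψ : Set H) = singularSubspace A

/-- The operator `A₁ ⊕ A₂` on the Hilbert space direct sum `K₁ ⊕ K₂`. -/
def directSumOp {K₁ K₂ : Type*} [NormedAddCommGroup K₁] [InnerProductSpace ℂ K₁]
    [NormedAddCommGroup K₂] [InnerProductSpace ℂ K₂]
    (A₁ : K₁ →L[ℂ] K₁) (A₂ : K₂ →L[ℂ] K₂) :
    WithLp 2 (K₁ × K₂) →L[ℂ] WithLp 2 (K₁ × K₂) :=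
  ((WithLp.prodContinuousLinearEquiv 2 ℂ K₁ K₂).symm : (K₁ × K₂) →L[ℂ] WithLp 2 (K₁ × K₂)) ∘L
    (A₁.prodMap A₂) ∘L
    ((WithLp.prodContinuousLinearEquiv 2 ℂ K₁ K₂) : WithLp 2 (K₁ × K₂) →L[ℂ] (K₁ × K₂))

end

/-! Write `A = A₁ ⊕ A₂`, let `B` be the projection onto `K₁`, let `N` be the orthogonal complement
of the `A`-cyclic subspace of `φ`, with projection `Q`, and put `η = QBφ`. The rank one term
vanishes on `N`, which reduces both operators, so `C = A` there and `η` has the same spectral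
measure for `C` as for `A`. Since `QB` commutes with `A`, this measure is absolutely continuous with
respect to that of `φ` for `A`. As `φ` and `Bφ` together generate `H` under `A`, the vectors `φ` and
`η` generate `H` under `C`.

By Aronszajn–Donoghue (`mutuallySingular_of_rankOne_perturbation`) the singular parts of the
measures of `φ` for `A` and for `C` are mutually singular; hence so are those of `η` and `φ` for
`C`. The sum of the singular components of `φ` and `η` is then cyclic for the singular subspace
(`hasSimpleSingularSpectrum_of_two_vectors`).

Spectral projections are replaced by orthogonal projections onto `spectralNullSubspace A S`, the
kernel of the spectral projection of `S`. -/

/-! ### Continuous approximation of indicators. -/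

/-- Continuous functions equal to `1` on `K` and decreasing to the indicator of `closure K`. -/
noncomputable def indicatorApprox (K : Set ℝ) (n : ℕ) (x : ℝ) : ℝ :=
  thickenedIndicator (δ := 1 / ((n : ℝ) + 1)) Nat.one_div_pos_of_nat K x

namespace indicatorApprox

open Filter Topology

variable (K : Set ℝ) (n : ℕ)

lemma continuous : Continuous (indicatorApprox K n) :=
  NNReal.continuous_coe.comp (thickenedIndicator _ K).continuous

lemma nonneg (x : ℝ) : 0 ≤ indicatorApprox K n x := NNReal.coe_nonneg _

lemma le_one (x : ℝ) : indicatorApprox K n x ≤ 1 := by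
  exact_mod_cast thickenedIndicator_le_one _ K x

variable {K}

lemma eq_one {x : ℝ} (hx : x ∈ K) : indicatorApprox K n x = 1 := by
  simp [indicatorApprox, thickenedIndicator_one _ K hx]

lemma eq_zero {x : ℝ} (hx : x ∉ Metric.thickening (1 / ((n : ℝ) + 1)) K) :
    indicatorApprox K n x = 0 := by
  rw [indicatorApprox, thickenedIndicator_zero _ K hx, NNReal.coe_zero]

/-- Supplies the common integrable majorant for dominated convergence. -/
lemma le_zero (x : ℝ) : indicatorApprox K n x ≤ indicatorApprox K 0 x := by
  have h := thickenedIndicator_mono (α := ℝ) (δ₁ := 1 / ((n : ℝ) + 1)) (δ₂ := 1 / (((0 : ℕ) : ℝ) + 1))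
    Nat.one_div_pos_of_nat Nat.one_div_pos_of_nat (by
      apply one_div_le_one_div_of_le <;> simp) K x
  exact NNReal.coe_le_coe.2 h

lemma hasCompactSupport (hK : IsCompact K) : HasCompactSupport (indicatorApprox K n) := by
  refine HasCompactSupport.intro (hK.cthickening (r := 1 / ((n : ℝ) + 1))) fun x hx => ?_
  exact eq_zero n fun h => hx (Metric.thickening_subset_cthickening _ _ h)

lemma tendsto (hK : IsClosed K) (x : ℝ) :
    Tendsto (fun n => indicatorApprox K n x) atTop (𝓝 (K.indicator 1 x)) := by
  have h := thickenedIndicator_tendsto_indicator_closure (α := ℝ)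
    (δseq := fun n : ℕ => 1 / ((n : ℝ) + 1)) (fun n => Nat.one_div_pos_of_nat)
    tendsto_one_div_add_atTop_nhds_zero_nat K
  have h2 := (NNReal.continuous_coe.tendsto _).comp (tendsto_pi_nhds.1 h x)
  rw [hK.closure_eq] at h2
  have h3 : K.indicator 1 x = ((K.indicator (fun _ => (1 : NNReal)) x : NNReal) : ℝ) := by
    by_cases hx : x ∈ K <;> simp [hx]
  rw [h3]
  exact h2

end indicatorApprox

/-! ### Spectral measures and their null subspaces. -/

section SpectralMeasure

open Filter Topology

variable {H : Type*} [NormedAddCommGroup H] [InnerProductSpace ℂ H] [CompleteSpace H]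

instance regular_spectralMeasure (A : H →L[ℂ] H) (ψ : H) : (spectralMeasure A ψ).Regular :=
  RealRMK.regular_rieszMeasure _

lemma integral_spectralMeasure (A : H →L[ℂ] H) (ψ : H) {f : ℝ → ℝ} (hf : Continuous f)
    (hfc : HasCompactSupport f) :
    ∫ x, f x ∂(spectralMeasure A ψ) = (⟪ψ, (cfc f A) ψ⟫_ℂ).re :=
  RealRMK.integral_rieszMeasure (spectralFunctional A ψ) ⟨⟨f, hf⟩, hfc⟩

lemma inner_cfc_left (A : H →L[ℂ] H) (f : ℝ → ℝ) (x y : H) :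
    ⟪cfc f A x, y⟫_ℂ = ⟪x, cfc f A y⟫_ℂ := by
  have h : IsSelfAdjoint (cfc f A) := cfc_predicate f A
  conv_lhs => rw [← h.adjoint_eq]
  exact ContinuousLinearMap.adjoint_inner_left _ _ _

lemma norm_cfc_apply_sq (A : H →L[ℂ] H) (ψ : H) {f : ℝ → ℝ} (hf : Continuous f)
    (hfc : HasCompactSupport f) :
    ‖cfc f A ψ‖ ^ 2 = ∫ x, f x ^ 2 ∂(spectralMeasure A ψ) := by
  have h := integral_spectralMeasure A ψ (f := fun x => f x ^ 2) (hf.pow 2)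
    (by simpa [pow_two] using! hfc.mul_left (f := f))
  rw [h, show cfc (fun x => f x ^ 2) A = cfc f A * cfc f A by
    rw [← cfc_mul f f A hf.continuousOn hf.continuousOn]; simp [pow_two]]
  rw [mul_apply_eq_comp, ← inner_cfc_left, inner_self_eq_norm_sq_to_K]
  norm_cast

lemma tendsto_norm_indicatorApprox_sq (A : H →L[ℂ] H) (ψ : H) {K : Set ℝ} (hK : IsCompact K) :
    Tendsto (fun n => ‖cfc (indicatorApprox K n) A ψ‖ ^ 2) atTop
      (𝓝 ((spectralMeasure A ψ).real K)) := by
  have h0 : Integrable (fun x => indicatorApprox K 0 x ^ 2) (spectralMeasure A ψ) :=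
    ((indicatorApprox.continuous K 0).pow 2).integrable_of_hasCompactSupport
      (by simpa [pow_two] using!
        (indicatorApprox.hasCompactSupport 0 hK).mul_left (f := indicatorApprox K 0))
  simp_rw [norm_cfc_apply_sq A ψ (indicatorApprox.continuous K _)
    (indicatorApprox.hasCompactSupport _ hK)]
  rw [← integral_indicator_one hK.measurableSet]
  refine tendsto_integral_of_dominated_convergence _
    (fun n => ((indicatorApprox.continuous K n).pow 2).aestronglyMeasurable) h0 ?_ ?_
  · intro n
    filter_upwards with x
    rw [Real.norm_of_nonneg (sq_nonneg _)]
    exact pow_le_pow_left₀ (indicatorApprox.nonneg K n x) (indicatorApprox.le_zero n x) 2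
  · filter_upwards with x
    have := (indicatorApprox.tendsto hK.isClosed x).pow 2
    convert this using 2
    by_cases hx : x ∈ K <;> simp [hx]

/-- By `norm_cfc_apply_sq`, distances between these vectors are `L²` distances between the
functions, which tend to zero by dominated convergence. -/
lemma cauchySeq_indicatorApprox (A : H →L[ℂ] H) (ψ : H) {K : Set ℝ} (hK : IsCompact K) :
    CauchySeq fun n => cfc (indicatorApprox K n) A ψ := by
  have hc := indicatorApprox.continuous K
  have hs := fun n => indicatorApprox.hasCompactSupport n hK
  have h0 : Integrable (fun x => indicatorApprox K 0 x ^ 2) (spectralMeasure A ψ) :=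
    ((hc 0).pow 2).integrable_of_hasCompactSupport
      (by simpa [pow_two] using! (hs 0).mul_left (f := indicatorApprox K 0))
  rw [cauchySeq_iff_tendsto_dist_atTop_0]
  have key : Tendsto (fun p : ℕ × ℕ => ∫ x, (indicatorApprox K p.1 x - indicatorApprox K p.2 x) ^ 2
      ∂(spectralMeasure A ψ)) atTop (𝓝 (∫ _, (0 : ℝ) ∂(spectralMeasure A ψ))) := by
    refine tendsto_integral_filter_of_dominated_convergence _
      (Eventually.of_forall fun p => (((hc p.1).sub (hc p.2)).pow 2).aestronglyMeasurable)
      (Eventually.of_forall fun p => ae_of_all _ fun x => ?_) h0 (ae_of_all _ fun x => ?_)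
    · rw [Real.norm_of_nonneg (sq_nonneg _)]
      refine sq_le_sq' ?_ ?_
      all_goals
        have := indicatorApprox.le_zero (K := K) p.1 x
        have := indicatorApprox.le_zero (K := K) p.2 x
        have := indicatorApprox.nonneg K p.1 x
        have := indicatorApprox.nonneg K p.2 x
        linarith
    · have h := indicatorApprox.tendsto hK.isClosed x
      rw [← prod_atTop_atTop_eq]
      simpa using ((h.comp tendsto_fst).sub (h.comp tendsto_snd)).pow 2
  have h2 : ∀ p : ℕ × ℕ, dist (cfc (indicatorApprox K p.1) A ψ) (cfc (indicatorApprox K p.2) A ψ)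
      = √(∫ x, (indicatorApprox K p.1 x - indicatorApprox K p.2 x) ^ 2
      ∂(spectralMeasure A ψ)) := by
    intro p
    rw [← norm_cfc_apply_sq A ψ (f := fun x => indicatorApprox K p.1 x - indicatorApprox K p.2 x)
      ((hc p.1).sub (hc p.2)) ((hs p.1).sub (hs p.2)), Real.sqrt_sq (norm_nonneg _), dist_eq_norm,
      cfc_sub _ _ A (hc p.1).continuousOn (hc p.2).continuousOn]
    rfl
  simp_rw [h2]
  simpa using key.sqrt

/-- The vectors to which the spectral measure of the set `S` assigns zero, described through
continuous approximations of the indicators of compact subsets of `S`. -/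
def spectralNullSubspace (A : H →L[ℂ] H) (S : Set ℝ) : Submodule ℂ H where
  carrier := {ψ | ∀ K ⊆ S, IsCompact K →
    Tendsto (fun n => cfc (indicatorApprox K n) A ψ) atTop (𝓝 0)}
  add_mem' := fun ha hb K hKS hK => by simpa using (ha K hKS hK).add (hb K hKS hK)
  zero_mem' := fun K hKS hK => by simp
  smul_mem' := fun c a ha K hKS hK => by simpa using (ha K hKS hK).const_smul c

/-- For compact `K` the squared norms of the approximants tend to the mass of `K`; inner regularity
passes from compact subsets to `S`. -/
lemma mem_spectralNullSubspace {A : H →L[ℂ] H} {S : Set ℝ} (hS : MeasurableSet S) {ψ : H} :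
    ψ ∈ spectralNullSubspace A S ↔ spectralMeasure A ψ S = 0 := by
  have key : ∀ K, IsCompact K → (Tendsto (fun n => cfc (indicatorApprox K n) A ψ) atTop (𝓝 0) ↔
      spectralMeasure A ψ K = 0) := by
    intro K hK
    have h := tendsto_norm_indicatorApprox_sq A ψ hK
    constructor
    · intro h0
      have h1 : (spectralMeasure A ψ).real K = 0 :=
        tendsto_nhds_unique h (by simpa using h0.norm.pow 2)
      exact (measureReal_eq_zero_iff hK.measure_lt_top.ne).1 h1
    · intro h0
      rw [measureReal_def, h0] at h
      rw [tendsto_zero_iff_norm_tendsto_zero]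
      simpa [Real.sqrt_sq] using h.sqrt
  constructor
  · intro h
    rw [hS.measure_eq_iSup_isCompact]
    simp only [ENNReal.iSup_eq_zero]
    exact fun K hKS hK => (key K hK).1 (h K hKS hK)
  · intro h K hKS hK
    exact (key K hK).2 (measure_mono_null hKS h)

lemma norm_cfc_indicatorApprox_apply_le (A : H →L[ℂ] H) (K : Set ℝ) (n : ℕ) (ψ : H) :
    ‖cfc (indicatorApprox K n) A ψ‖ ≤ ‖ψ‖ := by
  have h : ‖cfc (indicatorApprox K n) A‖ ≤ 1 := norm_cfc_le zero_le_one fun x _ => by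
    rw [Real.norm_of_nonneg (indicatorApprox.nonneg K n x)]
    exact indicatorApprox.le_one K n x
  simpa using ContinuousLinearMap.le_of_opNorm_le _ h ψ

lemma isClosed_spectralNullSubspace (A : H →L[ℂ] H) (S : Set ℝ) :
    IsClosed (spectralNullSubspace A S : Set H) := by
  refine isClosed_of_closure_subset fun ψ hψ K hKS hK => ?_
  rw [Metric.tendsto_atTop]
  intro ε hε
  obtain ⟨χ, hχ, hd⟩ := Metric.mem_closure_iff.1 hψ (ε / 2) (half_pos hε)
  obtain ⟨N, hN⟩ := Metric.tendsto_atTop.1 (hχ K hKS hK) (ε / 2) (half_pos hε)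
  refine ⟨N, fun n hn => ?_⟩
  have h1 := hN n hn
  have h2 := norm_cfc_indicatorApprox_apply_le A K n (ψ - χ)
  rw [dist_zero_right] at h1 ⊢
  rw [dist_eq_norm] at hd
  rw [map_sub] at h2
  have h3 := norm_sub_norm_le (cfc (indicatorApprox K n) A ψ) (cfc (indicatorApprox K n) A χ)
  linarith

instance (A : H →L[ℂ] H) (S : Set ℝ) : (spectralNullSubspace A S).HasOrthogonalProjection :=
  have := (isClosed_spectralNullSubspace A S).completeSpace_coe
  inferInstance

lemma spectralNullSubspace_anti (A : H →L[ℂ] H) {S T : Set ℝ} (h : S ⊆ T) :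
    spectralNullSubspace A T ≤ spectralNullSubspace A S :=
  fun _ hψ K hK => hψ K (hK.trans h)

lemma map_mem_spectralNullSubspace {A B : H →L[ℂ] H} (hB : Commute A B) {S : Set ℝ} {ψ : H}
    (hψ : ψ ∈ spectralNullSubspace A S) : B ψ ∈ spectralNullSubspace A S := by
  intro K hKS hK
  have h : ∀ n, cfc (indicatorApprox K n) A (B ψ) = B (cfc (indicatorApprox K n) A ψ) := fun n =>
    congrArg (fun T : H →L[ℂ] H => T ψ) (Commute.cfc_real hB (indicatorApprox K n)).eq
  simp_rw [h]
  simpa using! (B.continuous.tendsto 0).comp (hψ K hKS hK)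

lemma spectralMeasure_map_absolutelyContinuous {A B : H →L[ℂ] H} (hB : Commute A B) (ψ : H) :
    spectralMeasure A (B ψ) ≪ spectralMeasure A ψ := by
  refine Measure.AbsolutelyContinuous.mk fun S hS h => ?_
  rw [← mem_spectralNullSubspace hS] at h ⊢
  exact map_mem_spectralNullSubspace hB h

lemma cfc_eq_one_of_eqOn {A : H →L[ℂ] H} (hA : IsSelfAdjoint A) {f : ℝ → ℝ}
    (hf : ∀ x ∈ spectrum ℝ A, f x = 1) : cfc f A = 1 := by
  rw [cfc_congr (g := fun _ => 1) (fun x hx => hf x hx), cfc_const_one ℝ A]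

lemma spectralNullSubspace_univ {A : H →L[ℂ] H} (hA : IsSelfAdjoint A) :
    spectralNullSubspace A Set.univ = ⊥ := by
  rw [eq_bot_iff]
  intro ψ hψ
  -- On the compact spectrum every approximant equals `1`, so the sequence is constantly `ψ`.
  have h := hψ (spectrum ℝ A) (Set.subset_univ _) (spectrum.isCompact A)
  simp_rw [cfc_eq_one_of_eqOn hA fun x hx => indicatorApprox.eq_one _ hx] at h
  simpa using h

lemma spectralNullSubspace_inf {A : H →L[ℂ] H} {S T : Set ℝ} (hS : MeasurableSet S)
    (hT : MeasurableSet T) :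
    spectralNullSubspace A S ⊓ spectralNullSubspace A T = spectralNullSubspace A (S ∪ T) := by
  ext ψ
  rw [Submodule.mem_inf, mem_spectralNullSubspace hS, mem_spectralNullSubspace hT,
    mem_spectralNullSubspace (hS.union hT), measure_union_null_iff]

/-- The limit plays the role of the spectral projection of `K` applied to `ψ`. A compact `L`
disjoint from `K` has positive distance to it, so late approximants for `L` and `K` have product
zero. -/
lemma exists_tendsto_indicatorApprox (A : H →L[ℂ] H) (ψ : H) {K : Set ℝ} (hK : IsCompact K) :
    ∃ e ∈ spectralNullSubspace A Kᶜ,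
      Tendsto (fun n => cfc (indicatorApprox K n) A ψ) atTop (𝓝 e) := by
  obtain ⟨e, he⟩ := cauchySeq_tendsto_of_complete (cauchySeq_indicatorApprox A ψ hK)
  refine ⟨e, fun L hLK hL => ?_, he⟩
  obtain ⟨δ, hδ, hd⟩ := (Set.disjoint_left.2 fun x hx hx' => hLK hx hx' :
    Disjoint L K).exists_thickenings hL hK.isClosed
  obtain ⟨N, hN⟩ := exists_nat_one_div_lt hδ
  have hz : ∀ n, N ≤ n → ∀ m, N ≤ m →
      cfc (indicatorApprox L n) A (cfc (indicatorApprox K m) A ψ) = 0 := by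
    intro n hn m hm
    have h : cfc (indicatorApprox L n) A * cfc (indicatorApprox K m) A = 0 := by
      rw [← cfc_mul _ _ A (indicatorApprox.continuous L n).continuousOn
        (indicatorApprox.continuous K m).continuousOn, ← cfc_const_zero ℝ A]
      congr 1
      ext x
      have hmono : ∀ k, N ≤ k → 1 / ((k : ℝ) + 1) ≤ δ := fun k hk =>
        (one_div_le_one_div_of_le (by positivity) (by gcongr)).trans hN.le
      by_cases hx : x ∈ Metric.thickening δ L
      · rw [indicatorApprox.eq_zero (K := K) m fun h => Set.disjoint_left.1 hd hx
          (Metric.thickening_mono (hmono m hm) _ h), mul_zero]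
      · rw [indicatorApprox.eq_zero (K := L) n fun h => hx
          (Metric.thickening_mono (hmono n hn) _ h), zero_mul]
    exact congrArg (fun T : H →L[ℂ] H => T ψ) h
  refine tendsto_const_nhds.congr' ?_
  filter_upwards [eventually_ge_atTop N] with n hn
  refine (tendsto_nhds_unique (((cfc (indicatorApprox L n) A).continuous.tendsto e).comp he)
    (tendsto_const_nhds.congr' ?_)).symm
  filter_upwards [eventually_ge_atTop N] with m hm
  exact (hz n hn m hm).symm

/-- With `e` the limit of `fₙ(A)χ`, one has `⟪e, e⟫ = lim ⟪fₙ(A)e, χ⟫`, and each `fₙ(A)e` stays in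
the null subspace of `Sᶜ`, to which `χ` is orthogonal. -/
lemma spectralNullSubspace_compl_orthogonal_le (A : H →L[ℂ] H) (S : Set ℝ) :
    (spectralNullSubspace A Sᶜ)ᗮ ≤ spectralNullSubspace A S := by
  intro χ hχ K hKS hK
  obtain ⟨e, he, hlim⟩ := exists_tendsto_indicatorApprox A χ hK
  have h0 : ⟪e, χ⟫_ℂ = 0 :=
    hχ e (spectralNullSubspace_anti A (Set.compl_subset_compl.2 hKS) he)
  suffices h : e = 0 by rwa [h] at hlim
  have h1 : Tendsto (fun n => ⟪e, cfc (indicatorApprox K n) A χ⟫_ℂ) atTop (𝓝 ⟪e, e⟫_ℂ) :=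
    tendsto_const_nhds.inner hlim
  have h2 : ∀ n, ⟪e, cfc (indicatorApprox K n) A χ⟫_ℂ = 0 := fun n => by
    rw [← inner_cfc_left]
    exact hχ _ (map_mem_spectralNullSubspace
      (Commute.cfc_real (Commute.refl A) (indicatorApprox K n)).symm
      (spectralNullSubspace_anti A (Set.compl_subset_compl.2 hKS) he))
  simp_rw [h2] at h1
  exact inner_self_eq_zero.1 (tendsto_nhds_unique h1 tendsto_const_nhds)

end SpectralMeasure

/-! ### Cyclic subspaces and the singular subspace. -/

section Cyclic

variable {H : Type*} [NormedAddCommGroup H] [InnerProductSpace ℂ H]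

lemma commute_starProjection {B : H →L[ℂ] H} {U : Submodule ℂ H} [U.HasOrthogonalProjection]
    (h : ∀ x ∈ U, B x ∈ U) (h' : ∀ x ∈ Uᗮ, B x ∈ Uᗮ) : Commute B U.starProjection := by
  ext x
  refine (Submodule.eq_starProjection_of_mem_orthogonal (h _ (U.starProjection_apply_mem x)) ?_).symm
  simpa using! h' _ (U.sub_starProjection_mem_orthogonal x)

lemma pow_apply_mem_cyclicSubspace (A : H →L[ℂ] H) (ψ : H) (n : ℕ) :
    (A ^ n) ψ ∈ cyclicSubspace A ψ :=
  Submodule.le_topologicalClosure _ (Submodule.subset_span ⟨n, rfl⟩)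

lemma self_mem_cyclicSubspace (A : H →L[ℂ] H) (ψ : H) : ψ ∈ cyclicSubspace A ψ := by
  simpa using pow_apply_mem_cyclicSubspace A ψ 0

lemma cyclicSubspace_le {A : H →L[ℂ] H} {ψ : H} {U : Submodule ℂ H} (hU : IsClosed (U : Set H))
    (hA : ∀ x ∈ U, A x ∈ U) (hψ : ψ ∈ U) : cyclicSubspace A ψ ≤ U := by
  refine Submodule.topologicalClosure_minimal _ (Submodule.span_le.2 ?_) hU
  rintro _ ⟨n, rfl⟩
  induction n with
  | zero => simpa using hψ
  | succ n ih =>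
    simp only [pow_succ', mul_apply_eq_comp]
    exact hA _ ih

lemma map_mem_cyclicSubspace {A : H →L[ℂ] H} {ψ x : H} (hx : x ∈ cyclicSubspace A ψ) :
    A x ∈ cyclicSubspace A ψ := by
  have h : cyclicSubspace A ψ ≤ (cyclicSubspace A ψ).comap (A : H →ₗ[ℂ] H) := by
    refine Submodule.topologicalClosure_minimal _ (Submodule.span_le.2 ?_)
      ((Submodule.isClosed_topologicalClosure _).preimage A.continuous)
    rintro _ ⟨n, rfl⟩
    have := pow_apply_mem_cyclicSubspace A ψ (n + 1)
    rwa [pow_succ', mul_apply_eq_comp] at this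
  exact h hx

lemma mem_cyclicSubspace_orthogonal {A : H →L[ℂ] H} {ψ x : H} :
    x ∈ (cyclicSubspace A ψ)ᗮ ↔ ∀ n : ℕ, ⟪(A ^ n) ψ, x⟫_ℂ = 0 := by
  refine ⟨fun h n => h _ (pow_apply_mem_cyclicSubspace A ψ n), fun h => ?_⟩
  rw [cyclicSubspace, Submodule.orthogonal_closure, Submodule.mem_orthogonal]
  intro u hu
  induction hu using Submodule.span_induction with
  | mem x hx => obtain ⟨n, rfl⟩ := hx; exact h n
  | zero => simp
  | add x y _ _ hx hy => simp [inner_add_left, hx, hy]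
  | smul a x _ hx => simp [inner_smul_left, hx]

variable [CompleteSpace H]

instance (A : H →L[ℂ] H) (ψ : H) : (cyclicSubspace A ψ).HasOrthogonalProjection := by
  unfold cyclicSubspace
  infer_instance

lemma inner_map_left_of_isSelfAdjoint {A : H →L[ℂ] H} (hA : IsSelfAdjoint A) (x y : H) :
    ⟪A x, y⟫_ℂ = ⟪x, A y⟫_ℂ := by
  conv_lhs => rw [← hA.adjoint_eq]
  exact ContinuousLinearMap.adjoint_inner_left _ _ _

lemma inner_pow_map_left_of_isSelfAdjoint {A : H →L[ℂ] H} (hA : IsSelfAdjoint A) (n : ℕ) (x y : H) :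
    ⟪(A ^ n) x, y⟫_ℂ = ⟪x, (A ^ n) y⟫_ℂ :=
  inner_map_left_of_isSelfAdjoint (hA.pow n) x y

lemma map_mem_orthogonal {A : H →L[ℂ] H} (hA : IsSelfAdjoint A) {U : Submodule ℂ H}
    (hU : ∀ x ∈ U, A x ∈ U) {x : H} (hx : x ∈ Uᗮ) : A x ∈ Uᗮ := fun u hu => by
  rw [← inner_map_left_of_isSelfAdjoint hA]
  exact hx _ (hU u hu)

lemma commute_starProjection_of_isSelfAdjoint {A : H →L[ℂ] H} (hA : IsSelfAdjoint A)
    {U : Submodule ℂ H} [U.HasOrthogonalProjection] (hU : ∀ x ∈ U, A x ∈ U) :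
    Commute A U.starProjection :=
  commute_starProjection hU fun _ => map_mem_orthogonal hA hU

lemma commute_starProjection_cyclicSubspace {A : H →L[ℂ] H} (hA : IsSelfAdjoint A) (ψ : H) :
    Commute A (cyclicSubspace A ψ).starProjection :=
  commute_starProjection_of_isSelfAdjoint hA fun _ => map_mem_cyclicSubspace

lemma spectralNullSubspace_eq_orthogonal {A : H →L[ℂ] H} (hA : IsSelfAdjoint A) {S : Set ℝ}
    (hS : MeasurableSet S) :
    spectralNullSubspace A S = (spectralNullSubspace A Sᶜ)ᗮ := by
  refine le_antisymm (fun b hb => ?_) (spectralNullSubspace_compl_orthogonal_le A S)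
  set E := (spectralNullSubspace A Sᶜ).starProjection
  have h1 : b - E b ∈ (spectralNullSubspace A Sᶜ)ᗮ := Submodule.sub_starProjection_mem_orthogonal b
  have h2 : E b ∈ spectralNullSubspace A S := by
    have := Submodule.sub_mem _ hb (spectralNullSubspace_compl_orthogonal_le A S h1)
    rwa [sub_sub_cancel] at this
  have h3 : E b ∈ spectralNullSubspace A S ⊓ spectralNullSubspace A Sᶜ :=
    ⟨h2, Submodule.starProjection_apply_mem _ b⟩
  rw [spectralNullSubspace_inf hS hS.compl, Set.union_compl_self, spectralNullSubspace_univ hA,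
    Submodule.mem_bot] at h3
  rwa [h3, sub_zero] at h1

lemma commute_starProjection_spectralNullSubspace {A B : H →L[ℂ] H} (hAB : Commute A B)
    (hB : IsSelfAdjoint B) (S : Set ℝ) : Commute B (spectralNullSubspace A S).starProjection :=
  commute_starProjection_of_isSelfAdjoint hB fun _ => map_mem_spectralNullSubspace hAB

/-- If the spectral measures of `a` and `b` are mutually singular, then `a` is a limit of
polynomials in `A` applied to `a + b`. -/
lemma mem_cyclicSubspace_add {A : H →L[ℂ] H} (hA : IsSelfAdjoint A) {a b : H}
    (h : spectralMeasure A a ⟂ₘ spectralMeasure A b) : a ∈ cyclicSubspace A (a + b) := by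
  obtain ⟨S, hS, ha, hb⟩ := h
  rw [← mem_spectralNullSubspace hS] at ha
  rw [← mem_spectralNullSubspace hS.compl, spectralNullSubspace_eq_orthogonal hA hS.compl,
    compl_compl] at hb
  set E := (spectralNullSubspace A S).starProjection
  set P := (cyclicSubspace A (a + b)).starProjection
  have hE : E (a + b) = a := by
    rw [map_add, Submodule.starProjection_eq_self_iff.2 ha,
      (Submodule.starProjection_apply_eq_zero_iff _).2 hb, add_zero]
  -- Commutation gives `P a = P E (a + b) = E P (a + b) = a`.
  have hcomm : Commute P E := commute_starProjection_spectralNullSubspace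
    (commute_starProjection_cyclicSubspace hA _) (isSelfAdjoint_starProjection _) S
  have hP : P (a + b) = a + b :=
    Submodule.starProjection_eq_self_iff.2 (self_mem_cyclicSubspace A _)
  have h := congrArg (fun T : H →L[ℂ] H => T (a + b)) hcomm.eq
  simp only [mul_apply_eq_comp, hP, hE] at h
  exact Submodule.starProjection_eq_self_iff.1 h

lemma map_mem_singularSubspace {A B : H →L[ℂ] H} (hB : Commute A B) {ψ : H}
    (hψ : ψ ∈ singularSubspace A) : B ψ ∈ singularSubspace A :=
  Measure.MutuallySingular.mono_ac hψ (spectralMeasure_map_absolutelyContinuous hB ψ)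
    Measure.AbsolutelyContinuous.rfl

lemma mem_singularSubspace_iff {A : H →L[ℂ] H} {ψ : H} : ψ ∈ singularSubspace A ↔
    ∃ S, MeasurableSet S ∧ volume S = 0 ∧ ψ ∈ spectralNullSubspace A Sᶜ := by
  constructor
  · rintro ⟨S, hS, h1, h2⟩
    refine ⟨Sᶜ, hS.compl, h2, ?_⟩
    rwa [compl_compl, mem_spectralNullSubspace hS]
  · rintro ⟨S, hS, h1, h2⟩
    rw [mem_spectralNullSubspace hS.compl] at h2
    exact ⟨Sᶜ, hS.compl, h2, by rwa [compl_compl]⟩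

lemma add_mem_singularSubspace {A : H →L[ℂ] H} {a b : H} (ha : a ∈ singularSubspace A)
    (hb : b ∈ singularSubspace A) : a + b ∈ singularSubspace A := by
  rw [mem_singularSubspace_iff] at *
  obtain ⟨S, hS, h1, h2⟩ := ha
  obtain ⟨T, hT, h3, h4⟩ := hb
  refine ⟨S ∪ T, hS.union hT, measure_union_null h1 h3, Submodule.add_mem _
    (spectralNullSubspace_anti A ?_ h2) (spectralNullSubspace_anti A ?_ h4)⟩ <;>
  rw [Set.compl_subset_compl] <;> simp

lemma cyclicSubspace_subset_singularSubspace {A : H →L[ℂ] H} {ψ : H}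
    (hψ : ψ ∈ singularSubspace A) : (cyclicSubspace A ψ : Set H) ⊆ singularSubspace A := by
  obtain ⟨S, hS, h1, h2⟩ := mem_singularSubspace_iff.1 hψ
  exact fun χ hχ => mem_singularSubspace_iff.2 ⟨S, hS, h1,
    cyclicSubspace_le (isClosed_spectralNullSubspace A _)
      (fun _ => map_mem_spectralNullSubspace (Commute.refl A)) h2 hχ⟩

lemma inner_eq_zero_of_singular_of_absolutelyContinuous {A : H →L[ℂ] H} (hA : IsSelfAdjoint A)
    {a b : H} (ha : a ∈ singularSubspace A) (hb : spectralMeasure A b ≪ volume) :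
    ⟪b, a⟫_ℂ = 0 := by
  obtain ⟨S, hS, h1, h2⟩ := mem_singularSubspace_iff.1 ha
  rw [spectralNullSubspace_eq_orthogonal hA hS.compl, compl_compl] at h2
  exact h2 b ((mem_spectralNullSubspace hS).2 (hb h1))

/-- Splitting of a vector into a part with singular and a part with absolutely continuous
spectral measure. -/
lemma exists_singular_part {A : H →L[ℂ] H} (hA : IsSelfAdjoint A) (ψ : H) :
    ∃ B : H →L[ℂ] H, Commute A B ∧ B ψ ∈ singularSubspace A ∧
      spectralMeasure A (ψ - B ψ) ≪ volume := by
  set μ := spectralMeasure A ψ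
  obtain ⟨S, hS, h1, h2⟩ := Measure.mutuallySingular_singularPart μ volume
  have hcomm := commute_starProjection_spectralNullSubspace (Commute.refl A) hA S
  have hac : ψ - (spectralNullSubspace A S).starProjection ψ ∈ spectralNullSubspace A Sᶜ := by
    rw [spectralNullSubspace_eq_orthogonal hA hS.compl, compl_compl]
    exact Submodule.sub_starProjection_mem_orthogonal ψ
  refine ⟨(spectralNullSubspace A S).starProjection, hcomm, ?_, ?_⟩
  · refine mem_singularSubspace_iff.2 ⟨Sᶜ, hS.compl, h2, ?_⟩
    rw [compl_compl]
    exact Submodule.starProjection_apply_mem _ ψ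
  -- On `S` the measure of `ψ` has no singular part, and `Sᶜ` is null for the remaining component.
  · refine Measure.AbsolutelyContinuous.mk fun T hT hT0 => ?_
    have h3 : μ (T ∩ S) = 0 := by
      rw [← Measure.singularPart_add_rnDeriv μ volume]
      rw [Measure.add_apply, measure_mono_null Set.inter_subset_right h1, zero_add]
      exact withDensity_absolutelyContinuous _ _ (measure_mono_null Set.inter_subset_left hT0)
    have h4 : spectralMeasure A (ψ - (spectralNullSubspace A S).starProjection ψ) (T ∩ S) = 0 :=
      spectralMeasure_map_absolutelyContinuous
        (B := 1 - (spectralNullSubspace A S).starProjection)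
        ((Commute.one_right A).sub_right hcomm) ψ h3
    rw [mem_spectralNullSubspace hS.compl] at hac
    refine measure_mono_null (fun x hx => ?_) (measure_union_null h4 hac)
    by_cases hxS : x ∈ S
    · exact Or.inl ⟨hx, hxS⟩
    · exact Or.inr hxS

/-- If the cyclic subspaces of `φ` and `η` together span a dense subspace and the singular parts of
the spectral measures of `φ` and `η` are mutually singular, then `A` has simple singular spectrum. -/
lemma hasSimpleSingularSpectrum_of_two_vectors {A : H →L[ℂ] H} (hA : IsSelfAdjoint A) (φ η : H)
    (htot : ∀ χ, χ ∈ (cyclicSubspace A φ)ᗮ → χ ∈ (cyclicSubspace A η)ᗮ → χ = 0)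
    (hsing : ∀ B B' : H →L[ℂ] H, Commute A B → Commute A B' → B φ ∈ singularSubspace A →
      B' η ∈ singularSubspace A → spectralMeasure A (B φ) ⟂ₘ spectralMeasure A (B' η)) :
    HasSimpleSingularSpectrum A := by
  obtain ⟨B, hB, hBs, hBac⟩ := exists_singular_part hA φ
  obtain ⟨B', hB', hBs', hBac'⟩ := exists_singular_part hA η
  have hm := hsing B B' hB hB' hBs hBs'
  set ψ := B φ + B' η
  have h1 : B φ ∈ cyclicSubspace A ψ := mem_cyclicSubspace_add hA hm
  have h2 : B' η ∈ cyclicSubspace A ψ := by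
    simpa only [ψ, add_comm] using mem_cyclicSubspace_add hA hm.symm
  refine ⟨ψ, subset_antisymm
    (cyclicSubspace_subset_singularSubspace (add_mem_singularSubspace hBs hBs')) fun χ hχ => ?_⟩
  set P := (cyclicSubspace A ψ).starProjection
  have hP : Commute A P := commute_starProjection_cyclicSubspace hA ψ
  have h3 : χ - P χ ∈ singularSubspace A :=
    map_mem_singularSubspace (B := 1 - P) ((Commute.one_right A).sub_right hP) hχ
  have h4 : χ - P χ ∈ (cyclicSubspace A ψ)ᗮ := Submodule.sub_starProjection_mem_orthogonal χ
  -- The residual `χ - P χ` is orthogonal to the orbit of `D ξ`, which lies in the cyclic subspace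
  -- of `ψ`, and to that of `ξ - D ξ`, because singular and absolutely continuous vectors are
  -- orthogonal.
  have key : ∀ (ξ : H) (D : H →L[ℂ] H), Commute A D → D ξ ∈ cyclicSubspace A ψ →
      spectralMeasure A (ξ - D ξ) ≪ volume → χ - P χ ∈ (cyclicSubspace A ξ)ᗮ := by
    intro ξ D hD h5 h6
    rw [mem_cyclicSubspace_orthogonal]
    intro n
    have h7 : ⟪(A ^ n) (D ξ), χ - P χ⟫_ℂ = 0 := h4 _
      (cyclicSubspace_le (Submodule.isClosed_topologicalClosure _)
        (fun _ => map_mem_cyclicSubspace) h5 (pow_apply_mem_cyclicSubspace A (D ξ) n))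
    have h8 : ⟪(A ^ n) (ξ - D ξ), χ - P χ⟫_ℂ = 0 :=
      inner_eq_zero_of_singular_of_absolutelyContinuous hA h3
        ((spectralMeasure_map_absolutelyContinuous ((Commute.refl A).pow_right n) _).trans h6)
    rw [map_sub, inner_sub_left, h7, sub_zero] at h8
    exact h8
  have h9 := htot _ (key φ B hB h1 hBac) (key η B' hB' h2 hBac')
  rw [sub_eq_zero] at h9
  exact Submodule.starProjection_eq_self_iff.1 h9.symm

end Cyclic

/-! ### Aronszajn–Donoghue theory for rank one perturbations. -/

section RankOne

open Filter Topology

/-- A measure that is singular with respect to Lebesgue measure and dominated by `μ` is carried by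
the points where `μ` has infinite symmetric derivative. -/
lemma ae_tendsto_volume_div_of_singular {μ ν : Measure ℝ} [IsLocallyFiniteMeasure μ]
    (h : ν ≪ μ) (hs : ν ⟂ₘ volume) :
    ∀ᵐ x ∂ν, Tendsto (fun r => volume (Metric.closedBall x r) / μ (Metric.closedBall x r))
      (𝓝[>] 0) (𝓝 0) := by
  obtain ⟨S, hS, h1, h2⟩ := hs
  -- Lebesgue measure is differentiated with respect to `μ`, not conversely, so that the conclusion
  -- holds `μ`-a.e. and hence `ν`-a.e.
  have h3 : ∀ᵐ x ∂(μ.restrict Sᶜ), (volume : Measure ℝ).rnDeriv μ x = 0 := by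
    have h4 : ∫⁻ x in Sᶜ, (volume : Measure ℝ).rnDeriv μ x ∂μ = 0 :=
      le_antisymm ((Measure.setLIntegral_rnDeriv_le _).trans h2.le) zero_le
    exact (lintegral_eq_zero_iff (Measure.measurable_rnDeriv _ _)).1 h4
  rw [ae_restrict_iff' hS.compl] at h3
  have h5 : ∀ᵐ x ∂ν, x ∈ Sᶜ := by rwa [ae_iff, show {x | x ∉ Sᶜ} = S by ext; simp]
  filter_upwards [h.ae_le h3, h5, h.ae_le (Besicovitch.ae_tendsto_rnDeriv volume μ)] with x hx hxS hxt
  rwa [hx hxS] at hxt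

variable {H : Type*} [NormedAddCommGroup H] [InnerProductSpace ℂ H] [CompleteSpace H]

/-- `⟪A u, u⟫` is real, so the imaginary part comes from `z` alone. This both bounds resolvent
vectors and gives injectivity of `A - z`. -/
lemma im_mul_norm_sq_le_norm_inner {A : H →L[ℂ] H} (hA : IsSelfAdjoint A) (z : ℂ) (u : H) :
    z.im * ‖u‖ ^ 2 ≤ ‖⟪A u - z • u, u⟫_ℂ‖ := by
  have h1 : (⟪A u, u⟫_ℂ).im = 0 := by
    rw [← Complex.conj_eq_iff_im, inner_conj_symm, inner_map_left_of_isSelfAdjoint hA]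
  have h2 : (⟪A u - z • u, u⟫_ℂ).im = z.im * ‖u‖ ^ 2 := by
    rw [inner_sub_left, inner_smul_left, inner_self_eq_norm_sq_to_K, Complex.sub_im, h1,
      Complex.mul_im]
    simp [← Complex.ofReal_pow]
  rw [← h2]
  exact (le_abs_self _).trans (Complex.abs_im_le_norm _)

lemma exists_resolvent {A : H →L[ℂ] H} (hA : IsSelfAdjoint A) {z : ℂ} (hz : z.im ≠ 0) (φ : H) :
    ∃ u, A u - z • u = φ := by
  have h : z ∉ spectrum ℂ A := fun h => hz (hA.im_eq_zero_of_mem_spectrum h)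
  rw [spectrum.notMem_iff] at h
  obtain ⟨R, hR⟩ := h.exists_right_inv
  refine ⟨-(R φ), ?_⟩
  have h2 := congrArg (fun T : H →L[ℂ] H => T φ) hR
  simp [Algebra.algebraMap_eq_smul_one] at h2
  rw [map_neg, smul_neg, neg_sub_neg, h2]

open Polynomial in
lemma cfc_quadratic {A : H →L[ℂ] H} (hA : IsSelfAdjoint A) (x ε : ℝ) :
    cfc (fun t : ℝ => (t - x) ^ 2 + ε ^ 2) A
      = (A - (⟨x, -ε⟩ : ℂ) • (1 : H →L[ℂ] H)) * (A - (⟨x, ε⟩ : ℂ) • (1 : H →L[ℂ] H)) := by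
  have h := cfc_polynomial ((X - C x) ^ 2 + C (ε ^ 2)) A hA
  have h' : ((X - C x) ^ 2 + C (ε ^ 2) : ℝ[X]).eval = fun t => (t - x) ^ 2 + ε ^ 2 := by
    ext t; simp
  rw [h'] at h
  rw [h, map_add, map_pow, map_sub, aeval_X, aeval_C, aeval_C]
  have e1 : (⟨x, ε⟩ : ℂ) = x + ε * Complex.I := Complex.mk_eq_add_mul_I _ _
  have e2 : (⟨x, -ε⟩ : ℂ) = x - ε * Complex.I := by
    rw [Complex.mk_eq_add_mul_I]; push_cast; ring
  have e3 : ∀ r : ℝ, algebraMap ℝ (H →L[ℂ] H) r = (r : ℂ) • 1 := fun r => by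
    rw [Algebra.algebraMap_eq_smul_one, Complex.coe_smul]
  rw [e1, e2, e3, e3, pow_two]
  simp only [sub_mul, mul_sub, smul_mul_assoc, mul_smul_comm, one_mul, mul_one, smul_sub, smul_smul]
  have e4 : ((x : ℂ) + ε * Complex.I) * x - (x + ε * Complex.I) * (ε * Complex.I)
      = x * x + ((ε ^ 2 : ℝ) : ℂ) := by
    push_cast
    linear_combination (-(ε : ℂ) ^ 2) * Complex.I_sq
  rw [e4]
  module

/-- Substituting `φ = (A - z) u` and moving one factor across as its adjoint produces `(A - z̄)(A -
z)`, the quadratic weight. -/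
lemma inner_cfc_resolvent {A : H →L[ℂ] H} (hA : IsSelfAdjoint A) {φ u : H} {x ε : ℝ}
    (hu : A u - (⟨x, ε⟩ : ℂ) • u = φ) {f : ℝ → ℝ} (hf : Continuous f) :
    ⟪φ, cfc f A φ⟫_ℂ = ⟪u, cfc (fun t => f t * ((t - x) ^ 2 + ε ^ 2)) A u⟫_ℂ := by
  set D := A - (⟨x, ε⟩ : ℂ) • (1 : H →L[ℂ] H) with hDdef
  set D' := A - (⟨x, -ε⟩ : ℂ) • (1 : H →L[ℂ] H) with hDdef'
  have hD : φ = D u := by simp [D, ← hu]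
  have hadj : ContinuousLinearMap.adjoint D = D' := by
    rw [← ContinuousLinearMap.star_eq_adjoint, hDdef, star_sub, star_smul, star_one, hA.star_eq]
    rfl
  have hcomm : Commute (cfc f A) D' :=
    Commute.cfc_real ((Commute.refl A).sub_right ((Commute.one_right A).smul_right _)) f
  have hmul : cfc (fun t => f t * ((t - x) ^ 2 + ε ^ 2)) A = D' * (cfc f A * D) := by
    have hq : Continuous fun t : ℝ => (t - x) ^ 2 + ε ^ 2 := by fun_prop
    rw [cfc_mul f (fun t => (t - x) ^ 2 + ε ^ 2) A hf.continuousOn hq.continuousOn,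
      cfc_quadratic hA, ← mul_assoc, ← mul_assoc, hcomm.eq]
  rw [hmul, mul_apply_eq_comp, ← hadj, ContinuousLinearMap.adjoint_inner_right, hD]
  rfl

/-- The Borel transform bounds the mass of small intervals. -/
lemma measureReal_closedBall_le {A : H →L[ℂ] H} (hA : IsSelfAdjoint A) {φ u : H} {x r : ℝ}
    (hr : 0 < r) (hu : A u - (⟨x, 2 * r⟩ : ℂ) • u = φ) :
    3 / 4 * (spectralMeasure A φ).real (Metric.closedBall x r) ≤ 2 * r * ‖⟪φ, u⟫_ℂ‖ := by
  set ε := 2 * r with hε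
  have hε0 : 0 < ε := by positivity
  -- With `s = ((t - x) / ε)²` and `ε = 2r`, the bump is at least `3/4` on the ball, while `f · ε²
  -- (1 + s) ≤ ε² (1 - s²) ≤ ε²` where it is positive.
  set f : ℝ → ℝ := fun t => max 0 (1 - ((t - x) / ε) ^ 2) with hf
  have hfc : Continuous f := by fun_prop
  have hfs : HasCompactSupport f := by
    refine HasCompactSupport.intro (isCompact_closedBall x ε) fun t ht => ?_
    rw [Metric.mem_closedBall, Real.dist_eq, not_le] at ht
    refine max_eq_left (sub_nonpos.2 ?_)
    rw [div_pow, one_le_div (by positivity), ← sq_abs (t - x)]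
    exact pow_le_pow_left₀ hε0.le ht.le 2
  have h1 : 3 / 4 * (spectralMeasure A φ).real (Metric.closedBall x r)
      ≤ ∫ t, f t ∂(spectralMeasure A φ) := by
    have hi : Integrable f (spectralMeasure A φ) := hfc.integrable_of_hasCompactSupport hfs
    have h2 := setIntegral_ge_of_const_le_real (μ := spectralMeasure A φ) (f := f) (c := 3 / 4)
      (s := Metric.closedBall x r) measurableSet_closedBall
      (isCompact_closedBall x r).measure_lt_top.ne (fun t ht => ?_) hi.integrableOn
    · exact h2.trans (setIntegral_le_integral hi (ae_of_all _ fun t => le_max_left _ _))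
    · refine le_max_of_le_right ?_
      rw [Metric.mem_closedBall, Real.dist_eq] at ht
      have h3 : ((t - x) / ε) ^ 2 ≤ (1 / 2) ^ 2 := by
        rw [← sq_abs, abs_div, abs_of_pos hε0]
        refine pow_le_pow_left₀ (by positivity) ?_ 2
        rw [div_le_iff₀ hε0]
        linarith
      linarith
  rw [integral_spectralMeasure A φ hfc hfs] at h1
  set h : ℝ → ℝ := fun t => f t * ((t - x) ^ 2 + ε ^ 2) with hh
  have h2 : ⟪φ, cfc f A φ⟫_ℂ = ⟪u, cfc h A u⟫_ℂ := inner_cfc_resolvent hA hu hfc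
  have h3 : (⟪u, cfc h A u⟫_ℂ).re ≤ ε ^ 2 * ‖u‖ ^ 2 := by
    have hn : ‖cfc h A‖ ≤ ε ^ 2 := norm_cfc_le (by positivity) fun t _ => by
      have hf0 : 0 ≤ f t := le_max_left _ _
      rw [Real.norm_of_nonneg (by positivity)]
      have e : (t - x) ^ 2 + ε ^ 2 = ε ^ 2 * (1 + ((t - x) / ε) ^ 2) := by field_simp; ring
      simp only [hh]
      rw [e, mul_left_comm]
      refine mul_le_of_le_one_right (by positivity) ?_
      simp only [hf]
      set s := ((t - x) / ε) ^ 2 with hs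
      have hs0 : 0 ≤ s := by positivity
      rcases le_total (1 - s) 0 with h0 | h0
      · rw [max_eq_left h0]; simp
      · rw [max_eq_right h0]; nlinarith
    calc (⟪u, cfc h A u⟫_ℂ).re ≤ ‖⟪u, cfc h A u⟫_ℂ‖ := Complex.re_le_norm _
      _ ≤ ‖u‖ * ‖cfc h A u‖ := norm_inner_le_norm _ _
      _ ≤ ‖u‖ * (ε ^ 2 * ‖u‖) := by
        gcongr
        exact ContinuousLinearMap.le_of_opNorm_le _ hn u
      _ = ε ^ 2 * ‖u‖ ^ 2 := by ring
  have h4 := im_mul_norm_sq_le_norm_inner hA ⟨x, ε⟩ u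
  rw [hu] at h4
  rw [h2] at h1
  have h5 : ε * (ε * ‖u‖ ^ 2) ≤ ε * ‖⟪φ, u⟫_ℂ‖ := mul_le_mul_of_nonneg_left h4 hε0.le
  nlinarith

/-- Small Lebesgue density forces a large Borel transform: `6r ≤ (3c/4) μ(ball) ≤ 2rc ‖⟪φ, u⟫‖`. -/
lemma three_le_norm_inner_of_volume_div_lt {A : H →L[ℂ] H} (hA : IsSelfAdjoint A) {φ u : H}
    {x r c : ℝ} (hr : 0 < r) (hc : 0 < c) (hu : A u - (⟨x, 2 * r⟩ : ℂ) • u = φ)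
    (h : volume (Metric.closedBall x r) / spectralMeasure A φ (Metric.closedBall x r)
      < ENNReal.ofReal (c / 4)) : 3 ≤ c * ‖⟪φ, u⟫_ℂ‖ := by
  have hfin : spectralMeasure A φ (Metric.closedBall x r) ≠ ⊤ :=
    (isCompact_closedBall x r).measure_lt_top.ne
  have h1 := measureReal_closedBall_le hA hr hu
  have h2 : 2 * r ≤ c / 4 * (spectralMeasure A φ).real (Metric.closedBall x r) := by
    have hne : spectralMeasure A φ (Metric.closedBall x r) ≠ 0 := by
      intro h0
      rw [h0, ENNReal.div_zero (by simpa using hr)] at h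
      exact not_top_lt h
    have h3 := ((ENNReal.div_lt_iff (Or.inl hne) (Or.inl hfin)).1 h).le
    have h4 := ENNReal.toReal_mono (ENNReal.mul_ne_top ENNReal.ofReal_ne_top hfin) h3
    rwa [ENNReal.toReal_mul, ENNReal.toReal_ofReal (by positivity), Real.volume_closedBall,
      ENNReal.toReal_ofReal (by positivity)] at h4
  have h5 : 3 * (2 * r) ≤ (c * ‖⟪φ, u⟫_ℂ‖) * (2 * r) := by nlinarith
  exact le_of_mul_le_mul_right h5 (by positivity)

/-- **Aronszajn–Donoghue**: the singular parts of the spectral measures of `φ` for `A` and for the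
rank one perturbation `A + lam ⟨φ, ·⟩ φ` are mutually singular. -/
lemma mutuallySingular_of_rankOne_perturbation {A : H →L[ℂ] H} (hA : IsSelfAdjoint A) (φ : H)
    {lam : ℝ} (hlam : lam ≠ 0)
    (hC : IsSelfAdjoint (A + (lam : ℂ) • InnerProductSpace.rankOne ℂ φ φ)) {ν₁ ν₂ : Measure ℝ}
    (h₁ : ν₁ ≪ spectralMeasure A φ) (hs₁ : ν₁ ⟂ₘ volume)
    (h₂ : ν₂ ≪ spectralMeasure (A + (lam : ℂ) • InnerProductSpace.rankOne ℂ φ φ) φ)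
    (hs₂ : ν₂ ⟂ₘ volume) : ν₁ ⟂ₘ ν₂ := by
  set C := A + (lam : ℂ) • InnerProductSpace.rankOne ℂ φ φ with hCdef
  refine Measure.MutuallySingular.mk (ae_tendsto_volume_div_of_singular h₁ hs₁)
    (ae_tendsto_volume_div_of_singular h₂ hs₂) fun x _ => ?_
  by_contra hx
  simp only [Set.mem_union, Set.mem_ofPred_eq, not_or, not_not, Set.mem_compl_iff] at hx
  have hpos : (0 : ENNReal) < ENNReal.ofReal (|lam| / 4) := by simpa using hlam
  -- A single radius makes both Borel transforms large at the same point `z`.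
  obtain ⟨r, ⟨hr₁, hr₂⟩, hr⟩ := ((((hx.1.eventually (gt_mem_nhds hpos)).and
    (hx.2.eventually (gt_mem_nhds hpos))).and self_mem_nhdsWithin).exists)
  replace hr : 0 < r := hr
  have hz : ((⟨x, 2 * r⟩ : ℂ)).im ≠ 0 := by simpa using hr.ne'
  obtain ⟨u, hu⟩ := exists_resolvent hA hz φ
  obtain ⟨v, hv⟩ := exists_resolvent hC hz φ
  have hF := three_le_norm_inner_of_volume_div_lt hA hr (abs_pos.2 hlam) hu hr₁
  have hG := three_le_norm_inner_of_volume_div_lt hC hr (abs_pos.2 hlam) hv hr₂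
  set z : ℂ := ⟨x, 2 * r⟩
  set F := ⟪φ, u⟫_ℂ
  set G := ⟪φ, v⟫_ℂ
  -- Resolvent identity: `(C - z) u = (1 + lam F) φ`, and `C - z` is injective.
  have huv : u - (1 + lam * F) • v = 0 := by
    have h := im_mul_norm_sq_le_norm_inner hC z (u - (1 + lam * F) • v)
    have h0 : C (u - (1 + lam * F) • v) - z • (u - (1 + lam * F) • v) = 0 := by
      have hCu : C u = A u + (lam * F) • φ := by
        rw [hCdef, add_apply, smul_apply, InnerProductSpace.rankOne_apply, smul_smul]
      calc C (u - (1 + lam * F) • v) - z • (u - (1 + lam * F) • v)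
          = (A u - z • u) + (lam * F) • φ - (1 + lam * F) • (C v - z • v) := by
            rw [map_sub, map_smul, hCu]; module
        _ = 0 := by rw [hu, hv]; module
    rw [h0, inner_zero_left, norm_zero] at h
    have h1 : ‖u - (1 + lam * F) • v‖ ^ 2 ≤ 0 :=
      nonpos_of_mul_nonpos_right h (by simpa [z] using hr)
    simpa using h1
  have hFG : F * (1 - lam * G) = G := by
    have : F = (1 + lam * F) * G := by
      rw [← inner_smul_right, ← sub_eq_zero.1 huv]
    linear_combination this
  have h3 : ‖F‖ * (|lam| * ‖G‖ - 1) ≤ ‖G‖ := by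
    conv_rhs => rw [← hFG, norm_mul]
    refine mul_le_mul_of_nonneg_left ?_ (norm_nonneg _)
    have := norm_sub_norm_le ((lam : ℂ) * G) 1
    rw [norm_sub_rev, norm_mul, norm_one, Complex.norm_real, Real.norm_eq_abs] at this
    exact this
  have h4 : (|lam| * ‖F‖) * (|lam| * ‖G‖ - 1) ≤ |lam| * ‖G‖ := by
    rw [mul_assoc]
    exact mul_le_mul_of_nonneg_left h3 (abs_nonneg _)
  -- With `a = |lam|‖F‖ ≥ 3` and `b = |lam|‖G‖ ≥ 3`, `a (b - 1) ≥ 3 (b - 1) > b`, a contradiction.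
  nlinarith

end RankOne

/-! ### Intertwining relations and the abstract two-vector criterion. -/

section Intertwining

variable {H : Type*} [NormedAddCommGroup H] [InnerProductSpace ℂ H]

open Polynomial in
lemma SemiconjBy.aeval_right {A C Q : H →L[ℂ] H} (h : SemiconjBy Q A C) (p : ℝ[X]) :
    SemiconjBy Q (aeval A p) (aeval C p) := by
  induction p using Polynomial.induction_on' with
  | add p q hp hq => simpa using hp.add_right hq
  | monomial n a =>
    simp only [aeval_monomial, Algebra.algebraMap_eq_smul_one, smul_mul_assoc, one_mul]
    have := h.pow_right n
    simp only [SemiconjBy] at this ⊢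
    rw [mul_smul_comm, smul_mul_assoc, this]

variable [CompleteSpace H]

/-- Polynomials intertwine algebraically; Weierstrass approximation on one interval containing both
spectra extends this to `f`. -/
lemma SemiconjBy.cfc_right {A C Q : H →L[ℂ] H} (hA : IsSelfAdjoint A) (hC : IsSelfAdjoint C)
    (h : SemiconjBy Q A C) {f : ℝ → ℝ} (hf : Continuous f) : SemiconjBy Q (cfc f A) (cfc f C) := by
  obtain ⟨a, ha⟩ := ((spectrum.isCompact (𝕜 := ℝ) A).union
    (spectrum.isCompact (𝕜 := ℝ) C)).isBounded.subset_closedBall 0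
  rw [Real.closedBall_eq_Icc] at ha
  have key : ∀ ε > 0, ‖Q * cfc f A - cfc f C * Q‖ ≤ ε * (2 * ‖Q‖) := by
    intro ε hε
    obtain ⟨p, hp⟩ := exists_polynomial_near_of_continuousOn _ _ f hf.continuousOn ε hε
    have hclose : ∀ B : H →L[ℂ] H, IsSelfAdjoint B → spectrum ℝ B ⊆ Set.Icc (0 - a) (0 + a) →
        ‖cfc f B - Polynomial.aeval B p‖ ≤ ε := by
      intro B hB hs
      rw [← cfc_polynomial p B, ← cfc_sub f p.eval B]
      refine norm_cfc_le hε.le fun x hx => ?_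
      rw [Real.norm_eq_abs, abs_sub_comm]
      exact (hp x (hs hx)).le
    have h1 := hclose A hA (Set.subset_union_left.trans ha)
    have h2 := hclose C hC (Set.subset_union_right.trans ha)
    have e : Q * cfc f A - cfc f C * Q = Q * (cfc f A - Polynomial.aeval A p)
        - (cfc f C - Polynomial.aeval C p) * Q := by
      rw [mul_sub, sub_mul, (h.aeval_right p).eq]
      abel
    rw [e]
    calc _ ≤ ‖Q * (cfc f A - Polynomial.aeval A p)‖ + ‖(cfc f C - Polynomial.aeval C p) * Q‖ :=
          norm_sub_le _ _
      _ ≤ ‖Q‖ * ε + ε * ‖Q‖ := by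
        gcongr
        · exact (norm_mul_le _ _).trans (by gcongr)
        · exact (norm_mul_le _ _).trans (by gcongr)
      _ = _ := by ring
  have h0 : ‖Q * cfc f A - cfc f C * Q‖ ≤ 0 := by
    refine le_of_forall_pos_le_add fun δ hδ => ?_
    -- The `+ 1` covers `Q = 0`.
    have h3 := key (δ / (2 * ‖Q‖ + 1)) (by positivity)
    refine h3.trans ?_
    rw [zero_add, div_mul_eq_mul_div, div_le_iff₀ (by positivity)]
    nlinarith [norm_nonneg Q]
  exact sub_eq_zero.1 (norm_le_zero_iff.1 h0)

/-- `f(C) η = f(C) Q η = Q f(A) η = f(A) Q η = f(A) η`. -/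
lemma spectralMeasure_eq_of_semiconjBy {A C Q : H →L[ℂ] H} (hA : IsSelfAdjoint A)
    (hC : IsSelfAdjoint C) (h : SemiconjBy Q A C) (hQ : Commute A Q) {η : H} (hη : Q η = η) :
    spectralMeasure C η = spectralMeasure A η := by
  unfold spectralMeasure
  congr 1
  ext f
  have h1 := congrArg (fun T : H →L[ℂ] H => T η) (h.cfc_right hA hC f.continuous).eq
  have h2 := congrArg (fun T : H →L[ℂ] H => T η) (Commute.cfc_real hQ f).eq
  simp only [mul_apply_eq_comp, hη] at h1 h2
  exact congrArg (fun y => (⟪η, y⟫_ℂ).re) (h1.symm.trans h2.symm)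

lemma isSelfAdjoint_add_rankOne {A : H →L[ℂ] H} (hA : IsSelfAdjoint A) (φ : H) (lam : ℝ) :
    IsSelfAdjoint (A + (lam : ℂ) • InnerProductSpace.rankOne ℂ φ φ) := by
  refine hA.add (IsSelfAdjoint.smul ?_ ?_)
  · simp [isSelfAdjoint_iff]
  · rw [isSelfAdjoint_iff, ContinuousLinearMap.star_eq_adjoint,
      InnerProductSpace.adjoint_rankOne]

/-- Suppose a vector `Bφ`, with `B` in the commutant of `A`, and `φ` together generate a dense
subspace under `A`. Then the perturbation of `A` by a nonzero multiple of `⟨φ, ·⟩ φ` has simple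
singular spectrum. -/
theorem hasSimpleSingularSpectrum_add_rankOne {A B : H →L[ℂ] H} (hA : IsSelfAdjoint A)
    (hB : Commute A B) (φ : H)
    (htot : ∀ χ, χ ∈ (cyclicSubspace A φ)ᗮ → χ ∈ (cyclicSubspace A (B φ))ᗮ → χ = 0)
    {lam : ℝ} (hlam : lam ≠ 0) :
    HasSimpleSingularSpectrum (A + (lam : ℂ) • InnerProductSpace.rankOne ℂ φ φ) := by
  have hC := isSelfAdjoint_add_rankOne hA φ lam
  set C := A + (lam : ℂ) • InnerProductSpace.rankOne ℂ φ φ with hCdef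
  have hCx : ∀ x, C x = A x + (lam : ℂ) • ⟪φ, x⟫_ℂ • φ := fun x => by simp [hCdef]
  set N := (cyclicSubspace A φ)ᗮ
  set Q := N.starProjection
  have hφ : ∀ x ∈ N, ⟪φ, x⟫_ℂ = 0 := fun x hx => hx _ (self_mem_cyclicSubspace A φ)
  have hAN : ∀ x ∈ N, A x ∈ N := fun x =>
    map_mem_orthogonal hA fun _ => map_mem_cyclicSubspace
  have hCN : ∀ x ∈ N, C x = A x := fun x hx => by rw [hCx, hφ x hx]; simp
  have hAQ : Commute A Q := commute_starProjection_of_isSelfAdjoint hA hAN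
  have hsemi : SemiconjBy Q A C := by
    rw [SemiconjBy, ← hAQ.eq]
    ext x
    exact (hCN _ (N.starProjection_apply_mem x)).symm
  set η := Q (B φ)
  have hηN : η ∈ N := N.starProjection_apply_mem _
  have hμ : spectralMeasure C η ≪ spectralMeasure A φ := by
    rw [spectralMeasure_eq_of_semiconjBy hA hC hsemi hAQ (N.starProjection_eq_self_iff.2 hηN)]
    exact spectralMeasure_map_absolutelyContinuous (B := Q * B) (hAQ.mul_right hB) φ
  refine hasSimpleSingularSpectrum_of_two_vectors hC φ η (fun χ h1 h2 => ?_) ?_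
  · rw [mem_cyclicSubspace_orthogonal] at h1 h2
    -- Orthogonality to every `Cⁿφ` kills the rank one term at each iteration.
    have hpow : ∀ n, (A ^ n) χ = (C ^ n) χ := by
      intro n
      induction n with
      | zero => rfl
      | succ n ih =>
        rw [pow_succ', pow_succ', mul_apply_eq_comp, mul_apply_eq_comp, ih, hCx,
          ← inner_pow_map_left_of_isSelfAdjoint hC, h1 n]
        simp
    have hχ : χ ∈ N := mem_cyclicSubspace_orthogonal.2 fun n => by
      rw [inner_pow_map_left_of_isSelfAdjoint hA, hpow, ← inner_pow_map_left_of_isSelfAdjoint hC]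
      exact h1 n
    refine htot χ hχ (mem_cyclicSubspace_orthogonal.2 fun n => ?_)
    have hAχ : (A ^ n) χ ∈ N := by
      clear hpow h1 h2
      induction n with
      | zero => simpa using hχ
      | succ n ih =>
        rw [pow_succ', mul_apply_eq_comp]
        exact hAN _ ih
    have h3 := h2 n
    rw [inner_pow_map_left_of_isSelfAdjoint hC, ← hpow,
      N.inner_starProjection_left_eq_right, N.starProjection_eq_self_iff.2 hAχ] at h3
    rwa [inner_pow_map_left_of_isSelfAdjoint hA]
  · intro D D' hD hD' hs hs'
    -- The `η` measure is controlled by `φ` under `A`, the other by `φ` under `C`.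
    exact (mutuallySingular_of_rankOne_perturbation hA φ hlam hC
      ((spectralMeasure_map_absolutelyContinuous hD' η).trans hμ) hs'
      (spectralMeasure_map_absolutelyContinuous hD φ) hs).symm

end Intertwining

/-! ### The direct sum operator and the theorem. -/

section DirectSum

variable {K₁ K₂ : Type*} [NormedAddCommGroup K₁] [InnerProductSpace ℂ K₁]
  [NormedAddCommGroup K₂] [InnerProductSpace ℂ K₂]

lemma directSumOp_fst (A₁ : K₁ →L[ℂ] K₁) (A₂ : K₂ →L[ℂ] K₂) (x : WithLp 2 (K₁ × K₂)) :
    (directSumOp A₁ A₂ x).fst = A₁ x.fst := rfl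

lemma directSumOp_snd (A₁ : K₁ →L[ℂ] K₁) (A₂ : K₂ →L[ℂ] K₂) (x : WithLp 2 (K₁ × K₂)) :
    (directSumOp A₁ A₂ x).snd = A₂ x.snd := rfl

lemma directSumOp_mul (A₁ B₁ : K₁ →L[ℂ] K₁) (A₂ B₂ : K₂ →L[ℂ] K₂) :
    directSumOp A₁ A₂ * directSumOp B₁ B₂ = directSumOp (A₁ * B₁) (A₂ * B₂) := rfl

lemma directSumOp_pow (A₁ : K₁ →L[ℂ] K₁) (A₂ : K₂ →L[ℂ] K₂) (n : ℕ) :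
    directSumOp A₁ A₂ ^ n = directSumOp (A₁ ^ n) (A₂ ^ n) := by
  induction n with
  | zero => rfl
  | succ n ih => rw [pow_succ, pow_succ, pow_succ, ih, directSumOp_mul]

lemma IsCyclicVector.eq_zero {A : K₁ →L[ℂ] K₁} {ψ x : K₁} (h : IsCyclicVector A ψ)
    (hx : ∀ n : ℕ, ⟪(A ^ n) ψ, x⟫_ℂ = 0) : x = 0 := by
  rw [← mem_cyclicSubspace_orthogonal, show cyclicSubspace A ψ = ⊤ from h,
    Submodule.top_orthogonal_eq_bot] at hx
  exact hx

variable [CompleteSpace K₁] [CompleteSpace K₂]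

lemma isSelfAdjoint_directSumOp {A₁ : K₁ →L[ℂ] K₁} {A₂ : K₂ →L[ℂ] K₂} (hA₁ : IsSelfAdjoint A₁)
    (hA₂ : IsSelfAdjoint A₂) : IsSelfAdjoint (directSumOp A₁ A₂) := by
  rw [ContinuousLinearMap.isSelfAdjoint_iff_isSymmetric]
  intro x y
  simp only [ContinuousLinearMap.coe_coe, WithLp.prod_inner_apply]
  exact congrArg₂ (· + ·) (inner_map_left_of_isSelfAdjoint hA₁ x.fst y.fst)
    (inner_map_left_of_isSelfAdjoint hA₂ x.snd y.snd)

end DirectSum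

theorem theorem2 {K₁ K₂ : Type*}
    [NormedAddCommGroup K₁] [InnerProductSpace ℂ K₁] [CompleteSpace K₁]
    [NormedAddCommGroup K₂] [InnerProductSpace ℂ K₂] [CompleteSpace K₂]
    (A₁ : K₁ →L[ℂ] K₁) (A₂ : K₂ →L[ℂ] K₂)
    (hA₁ : IsSelfAdjoint A₁) (hA₂ : IsSelfAdjoint A₂)
    (φ : WithLp 2 (K₁ × K₂))
    (hφ₁ : IsCyclicVector A₁ φ.fst) (hφ₂ : IsCyclicVector A₂ φ.snd)
    (lam : ℝ) (hlam : lam ≠ 0) :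
    HasSimpleSingularSpectrum
      (directSumOp A₁ A₂ + (lam : ℂ) • InnerProductSpace.rankOne ℂ φ φ) := by
  -- `directSumOp 1 0` is the projection onto `K₁`: orthogonality to the orbit of its image of `φ`
  -- isolates the first coordinate, after which the orbit of `φ` controls the second.
  have hcomm : Commute (directSumOp A₁ A₂) (directSumOp 1 0) := by
    rw [Commute, SemiconjBy, directSumOp_mul, directSumOp_mul]
    simp
  refine hasSimpleSingularSpectrum_add_rankOne (isSelfAdjoint_directSumOp hA₁ hA₂) hcomm φ
    (fun χ h1 h2 => ?_) hlam
  rw [mem_cyclicSubspace_orthogonal] at h1 h2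
  simp only [directSumOp_pow, WithLp.prod_inner_apply] at h1 h2
  have hfst : χ.fst = 0 := hφ₁.eq_zero fun n => by
    simpa [directSumOp_fst, directSumOp_snd] using! h2 n
  have hsnd : χ.snd = 0 := hφ₂.eq_zero fun n => by
    have h := h1 n
    change ⟪_, χ.fst⟫_ℂ + _ = 0 at h
    rw [hfst, inner_zero_right, zero_add] at h
    exact h
  exact (WithLp.equiv 2 (K₁ × K₂)).injective (Prod.ext hfst hsnd)
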